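/- Let $R$ be an integral domain (commutative, with $1 \neq 0$, not assumed Noetherian), let $\mathcal{S}(R)$ be the set of all ideals of $R$, including $0$ and $R$, and let $\overline{\mathbb{N}} = \{0,1,2,\dots\} \cup \{\infty\}$. For a commutative ring $A$, a finite sequence $a_1,\dots,a_r$ $(r \ge 0)$ of elements of $A$ is a weak $A$-sequence if, for each $i = 1, \dots, r$, $a_i$ is not a zerodivisor on the $A$-module $A/(a_1,\dots,a_{i-1})$ (that is, multiplication by $a_i$ is injective on it; the module may be zero). The grade $\operatorname{grade}_A(\mathfrak a) \in \overline{\mathbb{N}}$ of an ideal $\mathfrak a$ of $A$ is the supremum of the lengths of the weak $A$-sequences all of whose terms lie in $\mathfrak a$. For $I \in \mathcal{S}(R)$ the polynomial grade of $I$ is \[ \operatorname{p.grade}(I) = \lim_{m\to\infty} \operatorname{grade}_{R[X_1,\dots,X_m]}\bigl(I[X_1,\dots,X_m]\bigr), \] where $I[X_1,\dots,X_m]$ is the extension of $I$ to $R[X_1,\dots,X_m]$. Then this limit exists in $\overline{\mathbb{N}}$ for every $I \in \mathcal{S}(R)$, and $\operatorname{p.grade} \colon \mathcal{S}(R) \to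 \overline{\mathbb{N}}$ is an ideal valuation on $R$; that is: 1. $\operatorname{p.grade}(0) = 0$ and $\operatorname{p.grade}(R) = \infty$; 2. $\min\{\operatorname{p.grade}(I), \operatorname{p.grade}(J)\} \le \operatorname{p.grade}(IJ)$ for all $I, J \in \mathcal{S}(R)$; 3. $\operatorname{p.grade}(I) = \sup\{\operatorname{p.grade}(J) \mid J \subseteq I,\ J \text{ a finitely generated ideal of } R\}$ for every $I \in \mathcal{S}(R)$. -/

import Mathlib

/-!
Only the product inequality is deep. Suppose that in some polynomial ring the extensions of `I` and
of `J` both contain weakly regular sequences longer than the longest one, `fs`, in the extension of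
`I * J`. By the long exact sequences of `Ext` along `fs`, `Hom(N, A ⧸ (fs)) = 0` for a module `N`
over the polynomial ring `A` as soon as `Ext N A i = 0` for all `i ≤ fs.length`, and these groups
vanish if a longer weakly `A`-regular sequence annihilates `N`. Hence the ideal `L` generated by
`fs` satisfies `L : I₀ = L` and `L : J₀ = L`, where `I₀` and `J₀` are generated by the longer
sequences, and so `L : I₀ * J₀ = L`. A polynomial in one new variable whose coefficients generate
`I₀ * J₀` is then, by McCoy's theorem, a nonzerodivisor modulo `L`: it prolongs `fs`, so the grade
of `I * J` increases with the number of variables as long as it is smaller than those of `I` and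
of `J`.
-/

open Filter Topology

noncomputable section

/-- The classical grade of an ideal `I` of `R`: the supremum in `ℕ∞` of the lengths of the
weak `R`-sequences whose terms all lie in `I`. -/
def classicalGrade {R : Type*} [CommRing R] (I : Ideal R) : ℕ∞ :=
  sSup {n : ℕ∞ | ∃ a : List R, (∀ x ∈ a, x ∈ I) ∧
    RingTheory.Sequence.IsWeaklyRegular R a ∧ n = (a.length : ℕ∞)}

/-- The grade of the extension `I[X₁, …, Xₘ]` of `I` to the polynomial ring `R[X₁, …, Xₘ]`. -/
def gradeInVariables {R : Type*} [CommRing R] (I : Ideal R) (m : ℕ) : ℕ∞ :=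
  classicalGrade (I.map (MvPolynomial.C : R →+* MvPolynomial (Fin m) R))

/-- The polynomial grade of `I`: the limit, as `m → ∞`, of the grades of `I[X₁, …, Xₘ]`.
The topology on `ℕ∞` is the order topology. -/
def polynomialGrade {R : Type*} [CommRing R] (I : Ideal R) : ℕ∞ :=
  limUnder atTop (fun m : ℕ => gradeInVariables I m)

/-- Ideal valuations on a domain `R`. -/
structure IsIdealValuation {R : Type*} [CommRing R] [IsDomain R] (ν : Ideal R → ℕ∞) : Prop where
  map_bot : ν ⊥ = 0
  map_top : ν ⊤ = ⊤
  min_le_map_mul : ∀ I J : Ideal R, min (ν I) (ν J) ≤ ν (I * J)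
  eq_sSup_fg : ∀ I : Ideal R, ν I = sSup {n : ℕ∞ | ∃ J : Ideal R, J ≤ I ∧ J.FG ∧ n = ν J}

end

section ExtVanishing

open CategoryTheory Abelian Pointwise RingTheory.Sequence

universe u v

variable {R : Type u} [CommRing R] [Small.{v} R]

lemma subsingleton_ext_succ_of_quotSMulTop {N M : ModuleCat.{v} R} {r : R}
    (hr : IsSMulRegular M r) (hrN : r ∈ Module.annihilator R N) {i : ℕ}
    (h : Subsingleton (Ext N (ModuleCat.of R (QuotSMulTop r M)) i)) :
    Subsingleton (Ext N M (i + 1)) := by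
  refine subsingleton_of_forall_eq 0 fun x ↦ ?_
  have smul_eq_zero : x.comp (Ext.mk₀ (r • 𝟙 M)) (add_zero (i + 1)) = 0 :=
    congr($(Ext.postcomp_smul_id_eq_zero_of_mem_annihilator (M := M) hrN (i + 1)) x)
  obtain ⟨y, rfl⟩ := Ext.covariant_sequence_exact₁ N hr.smulShortComplex_shortExact x
    smul_eq_zero rfl
  obtain rfl : y = 0 := h.elim y 0
  exact Ext.zero_comp ..

lemma subsingleton_ext_quotSMulTop {N M : ModuleCat.{v} R} {r : R} (hr : IsSMulRegular M r) {i : ℕ}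
    (h : Subsingleton (Ext N M i)) (h' : Subsingleton (Ext N M (i + 1))) :
    Subsingleton (Ext N (ModuleCat.of R (QuotSMulTop r M)) i) := by
  refine subsingleton_of_forall_eq 0 fun y ↦ ?_
  obtain ⟨x, rfl⟩ := Ext.covariant_sequence_exact₃ N hr.smulShortComplex_shortExact y rfl
    (h'.elim _ _)
  obtain rfl : x = 0 := h.elim x 0
  exact Ext.zero_comp ..

lemma subsingleton_ext_zero_iff {N M : ModuleCat.{v} R} :
    Subsingleton (Ext N M 0) ↔ Subsingleton (N →ₗ[R] M) :=
  (Ext.addEquiv₀.trans ModuleCat.homAddEquiv).toEquiv.subsingleton_congr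

lemma subsingleton_ext_of_isWeaklyRegular {N M : ModuleCat.{v} R} {rs : List R}
    (hrs : IsWeaklyRegular M rs) (hrsN : ∀ r ∈ rs, r ∈ Module.annihilator R N) {i : ℕ}
    (hi : i < rs.length) : Subsingleton (Ext N M i) := by
  induction rs generalizing M i with
  | nil => simp at hi
  | cons r rs ih =>
    rw [isWeaklyRegular_cons_iff] at hrs
    rw [List.forall_mem_cons] at hrsN
    cases i with
    | zero =>
      exact subsingleton_ext_zero_iff.mpr (hrs.1.linearMap_subsingleton_of_mem_annihilator hrsN.1)
    | succ i =>
      exact subsingleton_ext_succ_of_quotSMulTop hrs.1 hrsN.1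
        (ih (M := ModuleCat.of R (QuotSMulTop r M)) hrs.2 hrsN.2 (Nat.lt_of_succ_lt_succ hi))

lemma subsingleton_linearMap_quotient_of_subsingleton_ext {N M : ModuleCat.{v} R} {rs : List R}
    (hrs : IsWeaklyRegular M rs) (h : ∀ i ≤ rs.length, Subsingleton (Ext N M i)) :
    Subsingleton (N →ₗ[R] M ⧸ (Ideal.ofList rs • ⊤ : Submodule R M)) := by
  induction rs generalizing M with
  | nil =>
    have : Subsingleton (N →ₗ[R] M) := subsingleton_ext_zero_iff.mp (h 0 le_rfl)
    exact (LinearEquiv.congrRight (Submodule.quotEquivOfEqBot _ (by simp))).subsingleton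
  | cons r rs ih =>
    rw [isWeaklyRegular_cons_iff] at hrs
    have := ih (M := ModuleCat.of R (QuotSMulTop r M)) hrs.2 fun i hi ↦
      subsingleton_ext_quotSMulTop hrs.1 (h i (Nat.le_succ_of_le hi))
        (h (i + 1) (by simpa using hi))
    exact (LinearEquiv.congrRight
      (Submodule.quotOfListConsSMulTopEquivQuotSMulTopInner M r rs)).subsingleton

lemma mem_ofList_smul_top_of_forall_smul_mem {M : Type v} [AddCommGroup M] [Module R M]
    {as fs : List R} (has : IsWeaklyRegular M as) (hfs : IsWeaklyRegular M fs)
    (hlen : fs.length < as.length) {x : M}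
    (hx : ∀ a ∈ as, a • x ∈ (Ideal.ofList fs • ⊤ : Submodule R M)) :
    x ∈ (Ideal.ofList fs • ⊤ : Submodule R M) := by
  set L : Submodule R M := Ideal.ofList fs • ⊤
  let N : Submodule R (M ⧸ L) := R ∙ L.mkQ x
  have as_annihilate_N (a : R) (ha : a ∈ as) : a ∈ Module.annihilator R N := by
    rw [← Submodule.annihilator, Submodule.mem_annihilator_span_singleton, ← map_smul]
    exact (Submodule.Quotient.mk_eq_zero L).mpr (hx a ha)
  have hom_eq_zero : Subsingleton (N →ₗ[R] M ⧸ L) :=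
    subsingleton_linearMap_quotient_of_subsingleton_ext (N := ModuleCat.of R N)
      (M := ModuleCat.of R M) hfs fun i hi ↦
        subsingleton_ext_of_isWeaklyRegular has as_annihilate_N (hi.trans_lt hlen)
  have mkQ_x_eq_zero : L.mkQ x = 0 :=
    congr($(hom_eq_zero.elim N.subtype 0) ⟨L.mkQ x, Submodule.mem_span_singleton_self _⟩)
  exact (Submodule.Quotient.mk_eq_zero L).mp mkQ_x_eq_zero

end ExtVanishing

section Prolongation

open Polynomial RingTheory.Sequence

variable {R : Type*} [CommRing R]

lemma colon_ofList_le_of_isWeaklyRegular {as fs : List R} (has : IsWeaklyRegular R as)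
    (hfs : IsWeaklyRegular R fs) (hlen : fs.length < as.length) :
    (Ideal.ofList fs).colon (Ideal.ofList as : Set R) ≤ Ideal.ofList fs := fun s hs ↦ by
  have := mem_ofList_smul_top_of_forall_smul_mem has hfs hlen (x := s) fun a ha ↦ by
    simpa [mul_comm] using Submodule.mem_colon.mp hs a (Ideal.subset_span ha)
  simpa using this

lemma colon_mul_le {L I J : Ideal R} (hI : L.colon (I : Set R) ≤ L)
    (hJ : L.colon (J : Set R) ≤ L) : L.colon ((I * J : Ideal R) : Set R) ≤ L := fun s hs ↦
  hI <| Submodule.mem_colon.mpr fun a ha ↦ hJ <| Submodule.mem_colon.mpr fun b hb ↦ by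
    simpa [mul_assoc] using Submodule.mem_colon.mp hs (a * b) (Ideal.mul_mem_mul ha hb)

lemma contentIdeal_le_iff {p : R[X]} {I : Ideal R} : p.contentIdeal ≤ I ↔ ∀ i, p.coeff i ∈ I := by
  refine ⟨fun h i ↦ h (p.coeff_mem_contentIdeal i), fun h ↦ Ideal.span_le.mpr fun c hc ↦ ?_⟩
  obtain ⟨i, -, rfl⟩ := mem_coeffs_iff.mp hc
  exact h i

lemma exists_contentIdeal_eq_of_fg {K : Ideal R} (hK : K.FG) : ∃ p : R[X], p.contentIdeal = K := by
  classical
  obtain ⟨n, c, rfl⟩ := Submodule.fg_iff_exists_fin_generating_family.mp hK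
  refine ⟨ofFn n c, le_antisymm (contentIdeal_le_iff.mpr fun i ↦ ?_) (Submodule.span_le.mpr ?_)⟩
  · obtain hi | hi := lt_or_ge i n
    · rw [ofFn_coeff_eq_val_of_lt c hi]
      exact Submodule.subset_span ⟨_, rfl⟩
    · rw [ofFn_coeff_eq_zero_of_ge c hi]
      exact zero_mem _
  · rintro _ ⟨i, rfl⟩
    simpa using coeff_mem_contentIdeal (p := ofFn n c) (i : ℕ)

lemma mem_map_C_of_mul_mem_map_C {L : Ideal R} {p q : R[X]}
    (hp : L.colon (p.contentIdeal : Set R) ≤ L) (hpq : p * q ∈ L.map C) : q ∈ L.map C := by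
  let π := mapRingHom (Ideal.Quotient.mk L)
  have map_C_eq_ker : L.map C = RingHom.ker π := by rw [ker_mapRingHom, Ideal.mk_ker]
  rw [map_C_eq_ker, RingHom.mem_ker] at hpq ⊢
  have p_regular : π p ∈ nonZeroDivisors (R ⧸ L)[X] := by
    refine Polynomial.mem_nonZeroDivisors_iff.mpr fun a ha ↦ ?_
    obtain ⟨s, rfl⟩ := Ideal.Quotient.mk_surjective a
    have smul_coeff_mem (i : ℕ) : s * p.coeff i ∈ L := by
      simpa [π, ← map_mul, Ideal.Quotient.eq_zero_iff_mem] using congr(coeff $ha i)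
    refine Ideal.Quotient.eq_zero_iff_mem.mpr (hp ?_)
    rw [Polynomial.contentIdeal_def, Ideal.colon_span, Submodule.mem_colon]
    intro c hc
    obtain ⟨i, -, rfl⟩ := mem_coeffs_iff.mp hc
    exact smul_coeff_mem i
  rw [map_mul] at hpq
  exact mem_nonZeroDivisors_iff_left.mp p_regular _ hpq

lemma exists_isWeaklyRegular_map_C_append {fs : List R} (hfs : IsWeaklyRegular R fs) {K : Ideal R}
    (hK : K.FG) (hcolon : (Ideal.ofList fs).colon (K : Set R) ≤ Ideal.ofList fs) :
    ∃ p ∈ K.map C, IsWeaklyRegular R[X] (fs.map C ++ [p]) := by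
  obtain ⟨p, rfl⟩ := exists_contentIdeal_eq_of_fg hK
  refine ⟨p, Ideal.mem_map_C_iff.mpr p.coeff_mem_contentIdeal, ?_⟩
  rw [isWeaklyRegular_append_iff, isWeaklyRegular_singleton_iff]
  refine ⟨hfs.of_flat (S := R[X]), isSMulRegular_iff_right_eq_zero_of_smul.mpr fun q hq ↦ ?_⟩
  obtain ⟨q, rfl⟩ := Submodule.Quotient.mk_surjective _ q
  rw [← Submodule.Quotient.mk_smul] at hq
  simp only [Submodule.Quotient.mk_eq_zero, smul_eq_mul, Ideal.mul_top, ← Ideal.map_ofList]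
    at hq ⊢
  exact mem_map_C_of_mul_mem_map_C hcolon hq

end Prolongation

section ClassicalGrade

open RingTheory.Sequence

variable {R S : Type*} [CommRing R] [CommRing S]

lemma ofList_le_iff {rs : List R} {I : Ideal R} : Ideal.ofList rs ≤ I ↔ ∀ r ∈ rs, r ∈ I :=
  Ideal.span_le

lemma fg_ofList (rs : List R) : (Ideal.ofList rs).FG :=
  Submodule.fg_span rs.finite_toSet

lemma length_le_classicalGrade {I : Ideal R} {rs : List R} (hrs : IsWeaklyRegular R rs)
    (hI : Ideal.ofList rs ≤ I) : rs.length ≤ classicalGrade I :=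
  le_sSup ⟨rs, ofList_le_iff.mp hI, hrs, rfl⟩

lemma classicalGrade_le_iff {I : Ideal R} {n : ℕ∞} : classicalGrade I ≤ n ↔
    ∀ rs : List R, IsWeaklyRegular R rs → Ideal.ofList rs ≤ I → rs.length ≤ n := by
  refine ⟨fun h rs hrs hI ↦ (length_le_classicalGrade hrs hI).trans h, fun h ↦ sSup_le ?_⟩
  rintro _ ⟨rs, hI, hrs, rfl⟩
  exact h rs hrs (ofList_le_iff.mpr hI)

lemma lt_classicalGrade_iff {I : Ideal R} {n : ℕ∞} : n < classicalGrade I ↔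
    ∃ rs : List R, IsWeaklyRegular R rs ∧ Ideal.ofList rs ≤ I ∧ n < rs.length := by
  simpa using classicalGrade_le_iff.not

lemma exists_isWeaklyRegular_length_eq_classicalGrade {I : Ideal R} (h : classicalGrade I < ⊤) :
    ∃ rs : List R, IsWeaklyRegular R rs ∧ Ideal.ofList rs ≤ I ∧ rs.length = classicalGrade I := by
  have : Nonempty {n : ℕ∞ | ∃ a : List R, (∀ x ∈ a, x ∈ I) ∧ IsWeaklyRegular R a ∧
      n = (a.length : ℕ∞)} := ⟨0, [], by simp⟩
  obtain ⟨rs, hI, hrs, hlen⟩ := ENat.sSup_mem_of_nonempty_of_lt_top h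
  exact ⟨rs, hrs, ofList_le_iff.mpr hI, hlen.symm⟩

lemma classicalGrade_mono : Monotone (classicalGrade (R := R)) := fun _ _ hIJ ↦
  classicalGrade_le_iff.mpr fun _ hrs hI ↦ length_le_classicalGrade hrs (hI.trans hIJ)

lemma classicalGrade_bot [Nontrivial R] : classicalGrade (⊥ : Ideal R) = 0 := by
  refine nonpos_iff_eq_zero.mp (classicalGrade_le_iff.mpr fun rs hrs hbot ↦ ?_)
  cases rs with
  | nil => simp
  | cons r rs =>
    obtain rfl : r = 0 := ofList_le_iff.mp hbot r List.mem_cons_self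
    exact absurd ((isWeaklyRegular_cons_iff R 0 rs).mp hrs).1 IsSMulRegular.not_zero

lemma classicalGrade_top : classicalGrade (⊤ : Ideal R) = ⊤ := by
  refine ENat.eq_top_iff_forall_ge.mpr fun n ↦ ?_
  have hreg : IsWeaklyRegular R (List.replicate n (1 : R)) := by
    simp [isWeaklyRegular_iff, IsSMulRegular.one]
  simpa using length_le_classicalGrade hreg le_top

lemma classicalGrade_le_classicalGrade_map_of_flat {f : R →+* S} (hf : f.Flat) (I : Ideal R) :
    classicalGrade I ≤ classicalGrade (I.map f) := by
  refine classicalGrade_le_iff.mpr fun rs hrs hI ↦ ?_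
  algebraize [f]
  have map_le : Ideal.ofList (rs.map f) ≤ I.map f := by
    rw [← Ideal.map_ofList]
    exact Ideal.map_mono hI
  simpa using length_le_classicalGrade (hrs.of_flat (S := S)) map_le

lemma classicalGrade_map_ringEquiv (e : R ≃+* S) (I : Ideal R) :
    classicalGrade (I.map (e : R →+* S)) = classicalGrade I := by
  refine le_antisymm ?_ (classicalGrade_le_classicalGrade_map_of_flat (.of_bijective e.bijective) I)
  simpa [Ideal.map_map] using classicalGrade_le_classicalGrade_map_of_flat
    (.of_bijective e.symm.bijective : (e.symm : S →+* R).Flat) (I.map (e : R →+* S))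

lemma exists_fg_le_and_ofList_le_map {f : R →+* S} {I : Ideal R} {rs : List S}
    (h : Ideal.ofList rs ≤ I.map f) : ∃ J ≤ I, J.FG ∧ Ideal.ofList rs ≤ J.map f := by
  classical
  obtain ⟨T, hT, hrsT⟩ := Submodule.subset_span_finite_of_subset_span (t := rs.toFinset)
    (fun r hr ↦ ofList_le_iff.mp h r (by simpa using hr))
  obtain ⟨T, hTI, rfl⟩ := Finset.subset_set_image_iff.mp hT
  refine ⟨Ideal.span T, Ideal.span_le.mpr hTI, ⟨T, rfl⟩, ofList_le_iff.mpr fun r hr ↦ ?_⟩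
  rw [Ideal.map_span, ← Finset.coe_image]
  exact hrsT (by simpa using hr)

lemma exists_fg_lt_classicalGrade_map {f : R →+* S} {I : Ideal R} {n : ℕ∞}
    (h : n < classicalGrade (I.map f)) : ∃ J ≤ I, J.FG ∧ n < classicalGrade (J.map f) := by
  obtain ⟨rs, hrs, hI, hn⟩ := lt_classicalGrade_iff.mp h
  obtain ⟨J, hJI, hJ, hrsJ⟩ := exists_fg_le_and_ofList_le_map hI
  exact ⟨J, hJI, hJ, lt_classicalGrade_iff.mpr ⟨rs, hrs, hrsJ, hn⟩⟩

lemma classicalGrade_mul_lt_classicalGrade_map_C {I J : Ideal R}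
    (hI : classicalGrade (I * J) < classicalGrade I)
    (hJ : classicalGrade (I * J) < classicalGrade J) :
    classicalGrade (I * J) < classicalGrade ((I * J).map Polynomial.C) := by
  obtain ⟨fs, hfs, hfsIJ, hlen⟩ :=
    exists_isWeaklyRegular_length_eq_classicalGrade (hI.trans_le le_top)
  rw [← hlen] at hI hJ ⊢
  obtain ⟨as, has, hasI, hlen_as⟩ := lt_classicalGrade_iff.mp hI
  obtain ⟨bs, hbs, hbsJ, hlen_bs⟩ := lt_classicalGrade_iff.mp hJ
  obtain ⟨p, hp, hreg⟩ := exists_isWeaklyRegular_map_C_append hfs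
    ((fg_ofList as).mul (fg_ofList bs)) (colon_mul_le
      (colon_ofList_le_of_isWeaklyRegular has hfs (Nat.cast_lt.mp hlen_as))
      (colon_ofList_le_of_isWeaklyRegular hbs hfs (Nat.cast_lt.mp hlen_bs)))
  refine lt_classicalGrade_iff.mpr ⟨_, hreg, ?_, by norm_cast; simp⟩
  rw [Ideal.ofList_append, ← Ideal.map_ofList, Ideal.ofList_singleton]
  exact sup_le (Ideal.map_mono hfsIJ) <| (Ideal.span_singleton_le_iff_mem _).mpr <|
    Ideal.map_mono (Ideal.mul_mono hasI hbsJ) hp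

end ClassicalGrade

section PolynomialGrade

variable {R : Type*} [CommRing R]

lemma gradeInVariables_mono (m : ℕ) : Monotone fun I : Ideal R ↦ gradeInVariables I m :=
  fun _ _ h ↦ classicalGrade_mono (Ideal.map_mono h)

lemma gradeInVariables_succ (I : Ideal R) (m : ℕ) :
    gradeInVariables I (m + 1) = classicalGrade
      ((I.map (MvPolynomial.C : R →+* MvPolynomial (Fin m) R)).map Polynomial.C) := by
  let e := (MvPolynomial.finSuccEquiv R m).toRingEquiv
  have e_comp_C : (e : MvPolynomial (Fin (m + 1)) R →+* _).comp MvPolynomial.C =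
      Polynomial.C.comp (MvPolynomial.C : R →+* MvPolynomial (Fin m) R) :=
    RingHom.ext fun r ↦ by simp [e, MvPolynomial.finSuccEquiv_apply]
  rw [gradeInVariables, ← classicalGrade_map_ringEquiv e, Ideal.map_map, e_comp_C, Ideal.map_map]

lemma monotone_gradeInVariables (I : Ideal R) : Monotone (gradeInVariables I) := by
  refine monotone_nat_of_le_succ fun m ↦ ?_
  rw [gradeInVariables_succ]
  exact classicalGrade_le_classicalGrade_map_of_flat
    (RingHom.flat_algebraMap_iff.mpr inferInstance) _

lemma gradeInVariables_mul_lt_succ {I J : Ideal R} {m : ℕ}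
    (hI : gradeInVariables (I * J) m < gradeInVariables I m)
    (hJ : gradeInVariables (I * J) m < gradeInVariables J m) :
    gradeInVariables (I * J) m < gradeInVariables (I * J) (m + 1) := by
  rw [gradeInVariables_succ]
  simp only [gradeInVariables, Ideal.map_mul] at hI hJ ⊢
  simpa only [Ideal.map_mul] using classicalGrade_mul_lt_classicalGrade_map_C hI hJ

lemma tendsto_gradeInVariables (I : Ideal R) :
    Tendsto (gradeInVariables I) atTop (𝓝 (polynomialGrade I)) :=
  tendsto_nhds_limUnder ⟨_, tendsto_atTop_iSup (monotone_gradeInVariables I)⟩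

lemma polynomialGrade_eq_iSup (I : Ideal R) : polynomialGrade I = ⨆ m, gradeInVariables I m :=
  (tendsto_atTop_iSup (monotone_gradeInVariables I)).limUnder_eq

lemma gradeInVariables_le_polynomialGrade (I : Ideal R) (m : ℕ) :
    gradeInVariables I m ≤ polynomialGrade I := by
  rw [polynomialGrade_eq_iSup]
  exact le_iSup _ m

lemma eventually_gradeInVariables_eq {I : Ideal R} (h : polynomialGrade I < ⊤) :
    ∀ᶠ m in atTop, gradeInVariables I m = polynomialGrade I := by
  rw [polynomialGrade_eq_iSup] at h
  obtain ⟨k, hk⟩ := ENat.exists_eq_iSup_of_lt_top h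
  rw [← polynomialGrade_eq_iSup] at hk
  filter_upwards [eventually_ge_atTop k] with m hm
  exact (gradeInVariables_le_polynomialGrade I m).antisymm
    (hk.symm.le.trans (monotone_gradeInVariables I hm))

lemma lt_polynomialGrade_iff {I : Ideal R} {n : ℕ∞} :
    n < polynomialGrade I ↔ ∃ m, n < gradeInVariables I m := by
  rw [polynomialGrade_eq_iSup, lt_iSup_iff]

lemma polynomialGrade_mono : Monotone (polynomialGrade (R := R)) := fun I J h ↦ by
  simp only [polynomialGrade_eq_iSup]
  exact iSup_mono fun m ↦ gradeInVariables_mono m h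

lemma polynomialGrade_bot [Nontrivial R] : polynomialGrade (⊥ : Ideal R) = 0 := by
  simp [polynomialGrade_eq_iSup, gradeInVariables, Ideal.map_bot, classicalGrade_bot]

lemma polynomialGrade_top : polynomialGrade (⊤ : Ideal R) = ⊤ := by
  simp [polynomialGrade_eq_iSup, gradeInVariables, Ideal.map_top, classicalGrade_top]

lemma min_polynomialGrade_le_polynomialGrade_mul (I J : Ideal R) :
    min (polynomialGrade I) (polynomialGrade J) ≤ polynomialGrade (I * J) := by
  by_contra! h
  obtain ⟨hI, hJ⟩ := lt_min_iff.mp h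
  have eventually_eq : ∀ᶠ m in atTop, gradeInVariables (I * J) m = polynomialGrade (I * J) :=
    eventually_gradeInVariables_eq (hI.trans_le le_top)
  have eventually_lt : ∀ᶠ m in atTop, polynomialGrade (I * J) < gradeInVariables I m ∧
      polynomialGrade (I * J) < gradeInVariables J m :=
    ((tendsto_gradeInVariables I).eventually_const_lt hI).and
      ((tendsto_gradeInVariables J).eventually_const_lt hJ)
  obtain ⟨m, hm, hmI, hmJ⟩ := (eventually_eq.and eventually_lt).exists
  rw [← hm] at hmI hmJ
  exact ((gradeInVariables_mul_lt_succ hmI hmJ).trans_le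
    (gradeInVariables_le_polynomialGrade _ _)).ne hm

lemma polynomialGrade_eq_sSup_fg (I : Ideal R) : polynomialGrade I =
    sSup {n : ℕ∞ | ∃ J : Ideal R, J ≤ I ∧ J.FG ∧ n = polynomialGrade J} := by
  refine le_antisymm (le_of_forall_lt fun n hn ↦ ?_) (sSup_le ?_)
  · obtain ⟨m, hm⟩ := lt_polynomialGrade_iff.mp hn
    obtain ⟨J, hJI, hJ, hnJ⟩ := exists_fg_lt_classicalGrade_map hm
    exact (lt_polynomialGrade_iff.mpr ⟨m, hnJ⟩).trans_le (le_sSup ⟨J, hJI, hJ, rfl⟩)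
  · rintro _ ⟨J, hJI, -, rfl⟩
    exact polynomialGrade_mono hJI

end PolynomialGrade

theorem mainTheorem4_general {R : Type*} [CommRing R] [Nontrivial R] :
    (∀ I : Ideal R, Tendsto (gradeInVariables I) atTop (𝓝 (polynomialGrade I))) ∧
    polynomialGrade (⊥ : Ideal R) = 0 ∧ polynomialGrade (⊤ : Ideal R) = ⊤ ∧
    (∀ I J : Ideal R,
      min (polynomialGrade I) (polynomialGrade J) ≤ polynomialGrade (I * J)) ∧
    ∀ I : Ideal R, polynomialGrade I =
      sSup {n : ℕ∞ | ∃ J : Ideal R, J ≤ I ∧ J.FG ∧ n = polynomialGrade J} :=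
  ⟨tendsto_gradeInVariables, polynomialGrade_bot, polynomialGrade_top,
    min_polynomialGrade_le_polynomialGrade_mul, polynomialGrade_eq_sSup_fg⟩

theorem mainTheorem4 {R : Type*} [CommRing R] [IsDomain R] :
    (∀ I : Ideal R,
      Tendsto (fun m : ℕ => gradeInVariables I m) atTop (𝓝 (polynomialGrade I))) ∧
    IsIdealValuation (fun I : Ideal R => polynomialGrade I) :=
  have ⟨tendsto, bot, top, mul, fg⟩ := mainTheorem4_general (R := R)
  ⟨tendsto, bot, top, mul, fg⟩
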